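/- Let $N\in\mathbb N$, let $X\subset\mathbb R^N$ be compact, $\mu$ a Borel probability measure on $X$ and $T\colon X\to X$ a Lipschitz map. Then for a prevalent Lipschitz observable $h\colon X\to\mathbb R$, $h$ is almost surely $k$-predictable with respect to $\mu$ for every $k\in\mathbb N$ with $k>\dim_H\mu$. That is, the set of all $h\in\mathrm{Lip}(X)$ which are almost surely $k$-predictable with respect to $\mu$ for every integer $k>\dim_H\mu$ is prevalent in $\mathrm{Lip}(X)$. Here: * $\mathrm{Lip}(X)$ is the Banach space of Lipschitz functions $h\colon X\to\mathbb R$ with the norm $\|h\|=\sup_{x}|h(x)|+\sup_{x\ne y}\frac{|h(x)-h(y)|}{\|x-y\|}$. A set $\mathcal S\subset V$ in a complete linear metric space $V$ is *prevalent* if it contains a Borel set $B$ for which there is a Borel measure $\nu$ on $V$, positive and finite on some compact set, such that for every $v\in V$ we have $v+e\in B$ for $\nu$-almost every $e\in V$. * $\dim_H\mu$ is the infimum of the Hausdorff dimensions $\dim_H Y$ over all Borel sets $Y\subset\mathbb R^N$ of full $\mu$-measure. * For $h\colon X\to\mathbb R$ and $k\in\mathbb N$, the $k$-delay coordinate map is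 $\phi(x)=(h(x),h(Tx),\dots,h(T^{k-1}x))\in\mathbb R^k$. Let $B(y,\varepsilon)$ be the open Euclidean ball. For $y$ in the support of the push-forward measure $\phi_*\mu$ and $\varepsilon>0$, put $$\chi_\varepsilon(y)=\frac1{\mu(\phi^{-1}(B(y,\varepsilon)))}\int_{\phi^{-1}(B(y,\varepsilon))}\phi\circ T\,d\mu,$$ $$\sigma_\varepsilon(y)=\Big(\frac1{\mu(\phi^{-1}(B(y,\varepsilon)))}\int_{\phi^{-1}(B(y,\varepsilon))}\|\phi(Tx)-\chi_\varepsilon(y)\|^2\,d\mu(x)\Big)^{1/2}.$$ The point $y$ is *$k$-predictable* if it lies in the support of $\phi_*\mu$, these integrals exist for all small $\varepsilon>0$, and the limit $\sigma(y)=\lim_{\varepsilon\to0}\sigma_\varepsilon(y)$ exists and equals $0$. The observable $h$ is *almost surely $k$-predictable* with respect to $\mu$ if $\phi_*\mu$-almost every $y\in\mathbb R^k$ is $k$-predictable. -/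

import Mathlib

open MeasureTheory Filter Topology
open scoped NNReal ENNReal

/-! ### The Banach space of Lipschitz observables -/

/-- The linear space of real Lipschitz functions on a metric space `X`. -/
def lipSubmodule (X : Type*) [MetricSpace X] : Submodule ℝ (X → ℝ) where
  carrier := {h | ∃ K : ℝ≥0, LipschitzWith K h}
  add_mem' := by
    rintro f g ⟨K, hf⟩ ⟨L, hg⟩
    exact ⟨K + L, hf.add hg⟩
  zero_mem' := ⟨0, LipschitzWith.const 0⟩
  smul_mem' := by
    rintro c f ⟨K, hf⟩
    exact ⟨‖c‖₊ * K, (lipschitzWith_smul c).comp hf⟩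

/-- `Lip(X)`, the type of Lipschitz functions `X → ℝ`. It is a separate type, so that it carries
the topology of the Lipschitz norm and not the topology of pointwise convergence. -/
def LipSpace (X : Type*) [MetricSpace X] : Type _ := ↥(lipSubmodule X)

namespace LipSpace

section Basic

variable {X : Type*} [MetricSpace X]

instance : AddCommGroup (LipSpace X) := inferInstanceAs (AddCommGroup ↥(lipSubmodule X))

noncomputable instance : Module ℝ (LipSpace X) := inferInstanceAs (Module ℝ ↥(lipSubmodule X))

instance : CoeFun (LipSpace X) (fun _ => X → ℝ) := ⟨fun h => h.1⟩

theorem lipschitz (h : LipSpace X) : ∃ K : ℝ≥0, LipschitzWith K h := h.2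

@[ext] theorem ext {f g : LipSpace X} (hfg : ∀ x, f x = g x) : f = g :=
  Subtype.ext (funext hfg)

@[simp] theorem zero_apply (x : X) : (0 : LipSpace X) x = 0 := rfl

@[simp] theorem add_apply (f g : LipSpace X) (x : X) : (f + g) x = f x + g x := rfl

@[simp] theorem neg_apply (f : LipSpace X) (x : X) : (-f) x = -f x := rfl

@[simp] theorem sub_apply (f g : LipSpace X) (x : X) : (f - g) x = f x - g x := rfl

@[simp] theorem smul_apply (c : ℝ) (f : LipSpace X) (x : X) : (c • f) x = c * f x := rfl

/-- The Lipschitz norm `sup_x |h x| + sup_{x ≠ y} |h x - h y| / d(x, y)`. The diagonal terms of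
the second supremum are `0 / 0 = 0` and do not change it. Both suprema are finite on a compact
space. -/
noncomputable instance : Norm (LipSpace X) where
  norm h := (⨆ x, |h x|) + ⨆ p : X × X, |h p.1 - h p.2| / dist p.1 p.2

theorem norm_def (h : LipSpace X) :
    ‖h‖ = (⨆ x, |h x|) + ⨆ p : X × X, |h p.1 - h p.2| / dist p.1 p.2 := rfl

theorem sup_nonneg (h : LipSpace X) : 0 ≤ ⨆ x, |h x| := Real.iSup_nonneg fun _ => abs_nonneg _

theorem slope_nonneg (h : LipSpace X) : 0 ≤ ⨆ p : X × X, |h p.1 - h p.2| / dist p.1 p.2 :=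
  Real.iSup_nonneg fun _ => div_nonneg (abs_nonneg _) dist_nonneg

theorem norm_le {h : LipSpace X} {a b : ℝ} (ha : 0 ≤ a) (hb : 0 ≤ b) (h1 : ∀ x, |h x| ≤ a)
    (h2 : ∀ x y, |h x - h y| ≤ b * dist x y) : ‖h‖ ≤ a + b := by
  refine add_le_add (Real.iSup_le h1 ha) (Real.iSup_le (fun p => ?_) hb)
  rcases eq_or_ne p.1 p.2 with e | e
  · simpa [e] using hb
  · exact (div_le_iff₀ (dist_pos.2 e)).2 (h2 _ _)

theorem bddAbove_slope (h : LipSpace X) :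
    BddAbove (Set.range fun p : X × X => |h p.1 - h p.2| / dist p.1 p.2) := by
  obtain ⟨K, hK⟩ := h.lipschitz
  refine ⟨K, ?_⟩
  rintro _ ⟨p, rfl⟩
  exact div_le_of_le_mul₀ dist_nonneg K.2 (hK.dist_le_mul p.1 p.2)

theorem abs_sub_le (h : LipSpace X) (x y : X) :
    |h x - h y| ≤ (⨆ p : X × X, |h p.1 - h p.2| / dist p.1 p.2) * dist x y := by
  rcases eq_or_ne x y with rfl | e
  · simp
  · exact (div_le_iff₀ (dist_pos.2 e)).1 (le_ciSup h.bddAbove_slope (x, y))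

theorem abs_sub_le_norm (h : LipSpace X) (x y : X) : |h x - h y| ≤ ‖h‖ * dist x y :=
  (h.abs_sub_le x y).trans
    (mul_le_mul_of_nonneg_right (le_add_of_nonneg_left h.sup_nonneg) dist_nonneg)

end Basic

section Compact

variable {X : Type*} [MetricSpace X] [CompactSpace X]

theorem bddAbove_abs (h : LipSpace X) : BddAbove (Set.range fun x => |h x|) := by
  obtain ⟨K, hK⟩ := h.lipschitz
  exact (isCompact_range hK.continuous.abs).bddAbove

theorem abs_le_sup (h : LipSpace X) (x : X) : |h x| ≤ ⨆ x, |h x| := le_ciSup h.bddAbove_abs x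

theorem abs_le_norm (h : LipSpace X) (x : X) : |h x| ≤ ‖h‖ :=
  (h.abs_le_sup x).trans (le_add_of_nonneg_right h.slope_nonneg)

theorem normCore : NormedSpace.Core ℝ (LipSpace X) where
  norm_nonneg f := add_nonneg f.sup_nonneg f.slope_nonneg
  norm_smul c f := by
    simp only [norm_def, smul_apply, ← mul_sub, abs_mul, mul_div_assoc]
    rw [← Real.mul_iSup_of_nonneg (abs_nonneg c), ← Real.mul_iSup_of_nonneg (abs_nonneg c),
      ← mul_add, Real.norm_eq_abs]
  norm_triangle f g := by
    have h1 := norm_le (h := f + g) (add_nonneg f.sup_nonneg g.sup_nonneg)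
      (add_nonneg f.slope_nonneg g.slope_nonneg)
      (fun x => (abs_add_le _ _).trans (add_le_add (f.abs_le_sup x) (g.abs_le_sup x)))
      (fun x y => by
        rw [add_mul]
        refine le_trans ?_ (add_le_add (f.abs_sub_le x y) (g.abs_sub_le x y))
        simpa only [add_apply, add_sub_add_comm] using abs_add_le (f x - f y) (g x - g y))
    simp only [norm_def f, norm_def g]
    linarith
  norm_eq_zero_iff f := by
    constructor
    · intro hf
      ext x
      have := f.abs_le_norm x
      rw [hf] at this
      simpa using this
    · rintro rfl
      refine le_antisymm ?_ (add_nonneg (sup_nonneg _) (slope_nonneg _))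
      simpa using norm_le (h := (0 : LipSpace X)) le_rfl le_rfl (by simp) (by simp)

noncomputable instance : NormedAddCommGroup (LipSpace X) := NormedAddCommGroup.ofCore normCore

noncomputable instance : NormedSpace ℝ (LipSpace X) := NormedSpace.ofCore normCore

instance : CompleteSpace (LipSpace X) := by
  refine Metric.complete_of_cauchySeq_tendsto fun u hu => ?_
  have hpt : ∀ x, ∃ l, Tendsto (fun n => u n x) atTop (𝓝 l) := fun x => by
    refine cauchySeq_tendsto_of_complete (Metric.cauchySeq_iff.2 fun ε hε => ?_)
    obtain ⟨M, hM⟩ := Metric.cauchySeq_iff.1 hu ε hε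
    refine ⟨M, fun m hm n hn => lt_of_le_of_lt ?_ (hM m hm n hn)⟩
    rw [dist_eq_norm (u m), Real.dist_eq]
    exact (u m - u n).abs_le_norm x
  choose g hg using hpt
  have hbound : ∀ ε > 0, ∃ M, ∀ n ≥ M, (∀ x, |u n x - g x| ≤ ε) ∧
      ∀ x y, |(u n x - g x) - (u n y - g y)| ≤ ε * dist x y := fun ε hε => by
    obtain ⟨M, hM⟩ := Metric.cauchySeq_iff.1 hu ε hε
    have hM' : ∀ n ≥ M, ∀ m ≥ M, ‖u n - u m‖ ≤ ε := fun n hn m hm => by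
      rw [← dist_eq_norm]; exact (hM n hn m hm).le
    refine ⟨M, fun n hn => ⟨fun x => ?_, fun x y => ?_⟩⟩
    · refine le_of_tendsto ((tendsto_const_nhds.sub (hg x)).abs)
        (eventually_atTop.2 ⟨M, fun m hm => ?_⟩)
      exact ((u n - u m).abs_le_norm x).trans (hM' n hn m hm)
    · refine le_of_tendsto (((tendsto_const_nhds.sub (hg x)).sub
        (tendsto_const_nhds.sub (hg y))).abs) (eventually_atTop.2 ⟨M, fun m hm => ?_⟩)
      exact ((u n - u m).abs_sub_le_norm x y).trans
        (mul_le_mul_of_nonneg_right (hM' n hn m hm) dist_nonneg)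
  have hgL : g ∈ lipSubmodule X := by
    obtain ⟨M, hM⟩ := hbound 1 one_pos
    have hd : (fun x => u M x - g x) ∈ lipSubmodule X := by
      refine ⟨1, LipschitzWith.of_dist_le_mul fun x y => ?_⟩
      simpa only [Real.dist_eq, NNReal.coe_one] using (hM M le_rfl).2 x y
    have := (lipSubmodule X).sub_mem (u M).2 hd
    convert this using 1
    funext x
    simp
  let G : LipSpace X := ⟨g, hgL⟩
  refine ⟨G, Metric.tendsto_atTop.2 fun ε hε => ?_⟩
  obtain ⟨M, hM⟩ := hbound (ε / 3) (by positivity)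
  refine ⟨M, fun n hn => ?_⟩
  rw [dist_eq_norm]
  have := norm_le (h := u n - G) (by positivity) (by positivity) (hM n hn).1 (hM n hn).2
  linarith

/-- `Lip(X)` is equipped with the Borel σ-algebra of the norm topology. -/
noncomputable instance : MeasurableSpace (LipSpace X) := borel _

instance : BorelSpace (LipSpace X) := ⟨rfl⟩

end Compact

end LipSpace

/-! ### Prevalence -/

/-- Prevalence of a set in a complete linear metric space `V` (Hunt, Sauer and Yorke): `S` contains
a Borel set `B` for which there is a Borel measure `ν` on `V`, positive and finite on some compact
set, such that for every `v` the point `v + e` lies in `B` for `ν`-almost every `e`. -/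
def IsPrevalent {V : Type*} [AddCommGroup V] [Module ℝ V] [MetricSpace V] [CompleteSpace V]
    [IsTopologicalAddGroup V] [ContinuousSMul ℝ V] [MeasurableSpace V] [BorelSpace V]
    (S : Set V) : Prop :=
  ∃ B : Set V, B ⊆ S ∧ MeasurableSet B ∧
    ∃ ν : Measure V, (∃ C : Set V, IsCompact C ∧ 0 < ν C ∧ ν C < ∞) ∧
      ∀ v : V, ∀ᵐ e ∂ν, v + e ∈ B

/-! ### Hausdorff dimension of a measure -/

/-- `dim_H μ`: the infimum of the Hausdorff dimensions of the Borel sets of full `μ`-measure. -/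
noncomputable def measureDimH {E : Type*} [EMetricSpace E] [MeasurableSpace E] [BorelSpace E]
    (μ : Measure E) : ℝ≥0∞ :=
  ⨅ (s : Set E) (_ : MeasurableSet s) (_ : μ sᶜ = 0), dimH s

/-! ### Delay coordinates and the prediction error -/

section Prediction

variable {X : Type*}

/-- The `k`-delay coordinate map `φ(x) = (h x, h (T x), …, h (T^(k-1) x))`, with values in `ℝ^k`
with its Euclidean norm. -/
noncomputable def delayMap (T : X → X) (h : X → ℝ) (k : ℕ) (x : X) : EuclideanSpace ℝ (Fin k) :=
  WithLp.toLp 2 fun i => h (T^[i] x)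

variable [MeasurableSpace X]

/-- `χ_ε(y)`: the mean of `φ ∘ T` over `φ⁻¹(B(y, ε))` with respect to `μ`. -/
noncomputable def predMean (μ : Measure X) (T : X → X) (h : X → ℝ) (k : ℕ) (ε : ℝ)
    (y : EuclideanSpace ℝ (Fin k)) : EuclideanSpace ℝ (Fin k) :=
  ⨍ x in delayMap T h k ⁻¹' Metric.ball y ε, delayMap T h k (T x) ∂μ

/-- `σ_ε(y)`: the standard deviation of `φ ∘ T` over `φ⁻¹(B(y, ε))` with respect to `μ`. -/
noncomputable def predDev (μ : Measure X) (T : X → X) (h : X → ℝ) (k : ℕ) (ε : ℝ)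
    (y : EuclideanSpace ℝ (Fin k)) : ℝ :=
  Real.sqrt (⨍ x in delayMap T h k ⁻¹' Metric.ball y ε,
    ‖delayMap T h k (T x) - predMean μ T h k ε y‖ ^ 2 ∂μ)

/-- `y` is `k`-predictable: it lies in the support of `φ_*μ` (so that `μ (φ⁻¹(B(y, ε)))` is positive
for every `ε > 0`), the integrals defining `χ_ε(y)` and `σ_ε(y)` exist for small `ε > 0`, and the
prediction error `σ(y) = lim_{ε → 0} σ_ε(y)` exists and is `0`. -/
def IsPredictableAt (μ : Measure X) (T : X → X) (h : X → ℝ) (k : ℕ)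
    (y : EuclideanSpace ℝ (Fin k)) : Prop :=
  y ∈ (μ.map (delayMap T h k)).support ∧
  (∀ᶠ ε in 𝓝[>] (0 : ℝ),
    IntegrableOn (fun x => delayMap T h k (T x)) (delayMap T h k ⁻¹' Metric.ball y ε) μ ∧
    IntegrableOn (fun x => ‖delayMap T h k (T x) - predMean μ T h k ε y‖ ^ 2)
      (delayMap T h k ⁻¹' Metric.ball y ε) μ) ∧
  Tendsto (fun ε => predDev μ T h k ε y) (𝓝[>] 0) (𝓝 0)

/-- The Borel observable `h` is almost surely `k`-predictable with respect to `μ`: `φ_*μ`-almost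
every `y ∈ ℝ^k` is `k`-predictable. -/
def AlmostSurelyPredictable (μ : Measure X) (T : X → X) (h : X → ℝ) (k : ℕ) : Prop :=
  ∀ᵐ y ∂(μ.map (delayMap T h k)), IsPredictableAt μ T h k y

end Prediction

/-! Predictability does not need `φ` to be injective: it suffices that, on a set of full measure,
equality of the first `k` delay coordinates forces equality of all later ones. Then `φ ∘ T` is a
function of `φ` there, a continuous one on compact pieces, and differentiation of measures makes the
rest negligible in small balls, so `σ = 0` (`almostSurelyPredictable_of_factors`).

Fix `x`, and let `y` range over a compact set of dimension less than `k`. Suppose the observable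
agrees on the first `k` delay coordinates of `x` and `y` but not on a later one. If the functionals
`f ↦ f (T^i x) - f (T^i y)`, `i < k`, were dependent, the relation, shifted along the orbits, would
be a recurrence killing all later differences (`iterate_eq_of_dependent`). So they are independent,
even on polynomials of degree at most `2k`, which interpolate at the `2k` points involved. Each such
`y` thus confines the coefficients of a perturbation to an affine subspace of codimension `k`, and a
family of dimension less than `k` of these covers only a null set
(`measure_setOf_exists_surjective_eq_zero`). By Fubini, for almost every perturbation, `μ`-almost
every `x` has no such `y`. As only `y` varies, dimension below `k`, not `2k`, is the right scale. -/

/-! ### Prediction from a functional relation between `φ` and `φ ∘ T`. -/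

/-- A measurable set of finite measure is exhausted, up to a null set, by an increasing sequence of
compact subsets. -/
theorem exists_monotone_isCompact_exhaustion {X : Type*} [MetricSpace X] [CompactSpace X]
    [MeasurableSpace X] [BorelSpace X] (μ : Measure X) [IsFiniteMeasure μ] {A : Set X}
    (hA : MeasurableSet A) :
    ∃ K : ℕ → Set X, Monotone K ∧ (∀ n, IsCompact (K n)) ∧ (∀ n, K n ⊆ A) ∧
      μ (A \ ⋃ n, K n) = 0 := by
  have hex : ∀ n : ℕ, ∃ C ⊆ A, IsCompact C ∧ μ (A \ C) < (n + 1 : ℝ≥0∞)⁻¹ := fun n =>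
    hA.exists_isCompact_sdiff_lt (measure_ne_top μ A) (by simp)
  choose C hCA hC hlt using hex
  refine ⟨Set.accumulate C, Set.monotone_accumulate, fun n => ?_, fun n => ?_, ?_⟩
  · exact (Set.finite_Iic n).isCompact_biUnion fun i _ => hC i
  · exact Set.iUnion₂_subset fun i _ => hCA i
  · rw [Set.iUnion_accumulate]
    refine le_antisymm (ge_of_tendsto' (x := atTop)
      (f := fun n : ℕ => (n + 1 : ℝ≥0∞)⁻¹) ?_ fun n => ?_) zero_le
    · simpa using (tendsto_add_atTop_iff_nat 1).2 ENNReal.tendsto_inv_nat_nhds_zero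
    · exact (measure_mono (Set.sdiff_subset_sdiff_right (Set.subset_iUnion C n))).trans (hlt n).le

/-- On a compact set where `ψ` is a function of `φ`, it is a continuous one. -/
theorem IsCompact.exists_dist_lt_of_factors {X E F : Type*} [TopologicalSpace X] [MetricSpace E]
    [PseudoMetricSpace F] {C : Set X} (hC : IsCompact C) {φ : X → E} {ψ : X → F}
    (hφ : Continuous φ) (hψ : Continuous ψ) {x₀ : X}
    (hfac : ∀ x ∈ C, φ x = φ x₀ → ψ x = ψ x₀) {δ : ℝ} (hδ : 0 < δ) :
    ∃ ε > 0, ∀ x ∈ C, dist (φ x) (φ x₀) < ε → dist (ψ x) (ψ x₀) < δ := by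
  have hD : IsCompact (C ∩ {x | δ ≤ dist (ψ x) (ψ x₀)}) :=
    hC.inter_right (isClosed_le continuous_const (hψ.dist continuous_const))
  have hcl := (hD.image hφ).isClosed
  have hmem : (φ '' (C ∩ {x | δ ≤ dist (ψ x) (ψ x₀)}))ᶜ ∈ 𝓝 (φ x₀) := by
    refine hcl.isOpen_compl.mem_nhds ?_
    rintro ⟨x, ⟨hx, hx'⟩, he⟩
    have : δ ≤ dist (ψ x) (ψ x₀) := hx'
    rw [hfac x hx he, dist_self] at this
    linarith
  obtain ⟨ε, hε, hb⟩ := Metric.mem_nhds_iff.1 hmem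
  refine ⟨ε, hε, fun x hx hd => ?_⟩
  by_contra hcon
  exact hb (Metric.mem_ball.2 hd) ⟨x, ⟨hx, not_lt.1 hcon⟩, rfl⟩

/-- If the density of `ρ` with respect to `ν` is small at `x`, then `ρ` is small compared to `ν` on
small open balls around `x`. -/
theorem eventually_measure_ball_le {E : Type*} [MetricSpace E] [MeasurableSpace E]
    [BorelSpace E] (ρ ν : Measure E) [IsFiniteMeasure ν] {x : E}
    (hx : x ∈ ν.support) {a c : ℝ≥0∞}
    (ht : Tendsto (fun r => ρ (Metric.closedBall x r) / ν (Metric.closedBall x r))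
      (𝓝[>] 0) (𝓝 a)) (hac : a < c) :
    ∀ᶠ r in 𝓝[>] (0 : ℝ), ρ (Metric.ball x r) ≤ c * ν (Metric.ball x r) := by
  obtain ⟨R, hR, hlt⟩ := mem_nhdsGT_iff_exists_Ioo_subset.1 (ht.eventually_lt_const hac)
  have hclosed : ∀ r ∈ Set.Ioo 0 R,
      ρ (Metric.closedBall x r) ≤ c * ν (Metric.closedBall x r) := fun r hr => by
    have h1 : ρ (Metric.closedBall x r) / ν (Metric.closedBall x r) < c := hlt hr
    have h0 : ν (Metric.closedBall x r) ≠ 0 :=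
      ((Measure.mem_support_iff_forall x).1 hx _ (Metric.closedBall_mem_nhds x hr.1)).ne'
    exact (ENNReal.div_le_iff h0 (measure_ne_top _ _)).1 h1.le
  refine mem_nhdsGT_iff_exists_Ioo_subset.2 ⟨R, hR, fun r hr => ?_⟩
  -- Differentiation of measures is about closed balls, prediction about open ones; an open ball is
  -- an increasing union of closed balls, and `ρ` is continuous along it.
  obtain ⟨u, hu, hlt', hlim⟩ := exists_seq_strictMono_tendsto' hr.1
  have hball : Metric.ball x r = ⋃ n, Metric.closedBall x (u n) := by
    ext z
    simp only [Metric.mem_ball, Set.mem_iUnion, Metric.mem_closedBall]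
    refine ⟨fun hz => ?_, fun ⟨n, hn⟩ => hn.trans_lt (hlt' n).2⟩
    obtain ⟨n, hn⟩ := (hlim.eventually_const_lt hz).exists
    exact ⟨n, hn.le⟩
  have hmono : Monotone fun n => Metric.closedBall x (u n) := fun m n hmn =>
    Metric.closedBall_subset_closedBall (hu.monotone hmn)
  change ρ (Metric.ball x r) ≤ c * ν (Metric.ball x r)
  conv_lhs => rw [hball, hmono.measure_iUnion]
  refine iSup_le fun n => (hclosed _ ⟨(hlt' n).1, (hlt' n).2.trans hr.2⟩).trans ?_
  gcongr
  exact Metric.closedBall_subset_ball (hlt' n).2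

/-- For an increasing exhaustion `K n` of the space up to a null set, the conditional measure of
`(K n)ᶜ` on small balls of the factor space is eventually small. -/
theorem ae_exists_eventually_measure_compl_le {X E : Type*} [MeasurableSpace X]
    [NormedAddCommGroup E] [NormedSpace ℝ E] [FiniteDimensional ℝ E] [MeasurableSpace E]
    [BorelSpace E] (μ : Measure X) [IsFiniteMeasure μ] {φ : X → E} (hφ : Measurable φ)
    {K : ℕ → Set X} (hmono : Monotone K) (hK : ∀ n, MeasurableSet (K n))
    (hfull : μ (⋃ n, K n)ᶜ = 0) :
    ∀ᵐ y ∂(μ.map φ), ∀ c : ℝ≥0∞, 0 < c → ∃ n₀, ∀ n ≥ n₀, ∀ᶠ r in 𝓝[>] (0 : ℝ),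
      μ ((K n)ᶜ ∩ φ ⁻¹' Metric.ball y r) ≤ c * μ (φ ⁻¹' Metric.ball y r) := by
  set ν := μ.map φ with hν
  set ρ : ℕ → Measure E := fun n => (μ.restrict (K n)ᶜ).map φ with hρ
  have hac : ∀ n, ρ n ≪ ν := fun n =>
    Measure.AbsolutelyContinuous.map (Measure.restrict_le_self.absolutelyContinuous) hφ
  have hlim : Tendsto (fun n => ∫⁻ y, (ρ n).rnDeriv ν y ∂ν) atTop (𝓝 0) := by
    have h1 : ∀ n, ∫⁻ y, (ρ n).rnDeriv ν y ∂ν = μ (K n)ᶜ := fun n => by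
      rw [Measure.lintegral_rnDeriv (hac n), hρ]
      simp [Measure.map_apply hφ MeasurableSet.univ]
    simp_rw [h1]
    have := tendsto_measure_iInter_atTop (μ := μ) (s := fun n => (K n)ᶜ)
      (fun n => (hK n).compl.nullMeasurableSet) (fun m n h => Set.compl_subset_compl.2 (hmono h))
      ⟨0, measure_ne_top _ _⟩
    rwa [← Set.compl_iUnion, hfull] at this
  -- The infimum lies below densities whose integrals tend to `0`. One index with a small density is
  -- enough, because the sets `(K n)ᶜ` decrease.
  have hinf : ∀ᵐ y ∂ν, ⨅ n, (ρ n).rnDeriv ν y = 0 := by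
    have hm : Measurable fun y => ⨅ n, (ρ n).rnDeriv ν y :=
      Measurable.iInf fun n => Measure.measurable_rnDeriv _ _
    refine (lintegral_eq_zero_iff hm).1 (le_antisymm ?_ zero_le)
    exact ge_of_tendsto' hlim fun n => lintegral_mono fun y => iInf_le _ n
  have hder : ∀ᵐ y ∂ν, ∀ n, Tendsto (fun r => ρ n (Metric.closedBall y r) /
      ν (Metric.closedBall y r)) (𝓝[>] 0) (𝓝 ((ρ n).rnDeriv ν y)) :=
    ae_all_iff.2 fun n => Besicovitch.ae_tendsto_rnDeriv (ρ n) ν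
  filter_upwards [hinf, hder, Measure.support_mem_ae (μ := ν)] with y hy hd hs c hc
  obtain ⟨n₀, hn₀⟩ := iInf_lt_iff.1 (hy.trans_lt hc)
  refine ⟨n₀, fun n hn => ?_⟩
  filter_upwards [eventually_measure_ball_le (ρ n₀) ν hs (hd n₀) hn₀] with r hr
  rw [hν, hρ, Measure.map_apply hφ Metric.isOpen_ball.measurableSet,
    Measure.map_apply hφ Metric.isOpen_ball.measurableSet,
    Measure.restrict_apply (hφ Metric.isOpen_ball.measurableSet), Set.inter_comm] at hr
  exact (measure_mono (Set.inter_subset_inter_left _ (Set.compl_subset_compl.2 (hmono hn)))).trans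
    hr

/-- The conditional mean deviation of `ψ` from `ψ x₀` on the fibres over small balls tends to `0`,
if `ψ` is a function of `φ` on large compact sets. -/
theorem tendsto_setAverage_norm_sub {X E F : Type*} [TopologicalSpace X] [CompactSpace X]
    [MeasurableSpace X] [BorelSpace X] [MetricSpace E] [MeasurableSpace E] [BorelSpace E]
    [NormedAddCommGroup F] (μ : Measure X) [IsFiniteMeasure μ] {φ : X → E} {ψ : X → F}
    (hφ : Continuous φ) (hψ : Continuous ψ) {K : ℕ → Set X} (hK : ∀ n, IsCompact (K n))
    (hKm : ∀ n, MeasurableSet (K n)) {x₀ : X}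
    (hfac : ∀ n, ∀ x ∈ K n, φ x = φ x₀ → ψ x = ψ x₀)
    (hpos : ∀ r > 0, 0 < μ (φ ⁻¹' Metric.ball (φ x₀) r))
    (hdens : ∀ c : ℝ≥0∞, 0 < c → ∃ n, ∀ᶠ r in 𝓝[>] (0 : ℝ),
      μ ((K n)ᶜ ∩ φ ⁻¹' Metric.ball (φ x₀) r) ≤ c * μ (φ ⁻¹' Metric.ball (φ x₀) r)) :
    Tendsto (fun r => ⨍ x in φ ⁻¹' Metric.ball (φ x₀) r, ‖ψ x - ψ x₀‖ ∂μ) (𝓝[>] 0) (𝓝 0) := by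
  have hcont : Continuous fun x => ‖ψ x - ψ x₀‖ := (hψ.sub continuous_const).norm
  obtain ⟨D, hD⟩ := (isCompact_range hcont).bddAbove
  replace hD : ∀ x, ‖ψ x - ψ x₀‖ ≤ D := fun x => hD ⟨x, rfl⟩
  have hD0 : 0 ≤ D := (norm_nonneg _).trans (hD x₀)
  have hint : ∀ s : Set X, IntegrableOn (fun x => ‖ψ x - ψ x₀‖) s μ := fun s =>
    (Integrable.of_bound hcont.aestronglyMeasurable D (ae_of_all _ fun x => by
      simpa using hD x)).integrableOn
  refine Metric.tendsto_nhds.2 fun δ hδ => ?_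
  -- This constant leaves at most `δ / 4` for the part outside `K n`; the part inside takes `δ / 2`.
  -- The `+ 1` guards against `D = 0`.
  obtain ⟨n, hn⟩ := hdens (ENNReal.ofReal (δ / (4 * (D + 1)))) (ENNReal.ofReal_pos.2 (by positivity))
  obtain ⟨ε, hε, hclose⟩ := (hK n).exists_dist_lt_of_factors hφ hψ (hfac n) (half_pos hδ)
  filter_upwards [hn, Ioo_mem_nhdsGT hε] with r hr hrε
  set S := φ ⁻¹' Metric.ball (φ x₀) r with hS
  have hSm : MeasurableSet S := hφ.measurable Metric.isOpen_ball.measurableSet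
  have hm : 0 < μ.real S := ENNReal.toReal_pos (hpos r hrε.1).ne' (measure_ne_top _ _)
  have h1 : ∫ x in S ∩ K n, ‖ψ x - ψ x₀‖ ∂μ ≤ δ / 2 * μ.real S := by
    refine (setIntegral_mono_on (hint _) (integrable_const _) (hSm.inter (hKm n))
      (fun x hx => ?_)).trans (b := ∫ _ in S ∩ K n, δ / 2 ∂μ) ?_
    · rw [← dist_eq_norm]
      exact (hclose x hx.2 ((Metric.mem_ball.1 hx.1).trans hrε.2)).le
    · rw [setIntegral_const, smul_eq_mul, mul_comm]
      exact mul_le_mul_of_nonneg_left (measureReal_mono Set.inter_subset_left) (half_pos hδ).le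
  have h2 : ∫ x in S \ K n, ‖ψ x - ψ x₀‖ ∂μ ≤ D * (δ / (4 * (D + 1)) * μ.real S) := by
    refine (setIntegral_mono_on (hint _) (integrable_const _) (hSm.diff (hKm n))
      (fun x _ => hD x)).trans (b := ∫ _ in S \ K n, D ∂μ) ?_
    rw [setIntegral_const, smul_eq_mul, mul_comm]
    gcongr
    have := ENNReal.toReal_mono (ENNReal.mul_ne_top ENNReal.ofReal_ne_top (measure_ne_top _ _)) hr
    rw [ENNReal.toReal_mul, ENNReal.toReal_ofReal (by positivity)] at this
    rwa [Set.sdiff_eq, Set.inter_comm]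
  have h3 : D * (δ / (4 * (D + 1)) * μ.real S) ≤ δ / 4 * μ.real S := by
    have : D * (δ / (4 * (D + 1))) ≤ δ / 4 := by
      rw [mul_div_assoc', div_le_div_iff₀ (by positivity) (by positivity)]
      nlinarith
    nlinarith
  have h4 : ∫ x in S, ‖ψ x - ψ x₀‖ ∂μ < δ * μ.real S := by
    rw [← integral_inter_add_sdiff (hKm n) (hint S)]
    nlinarith
  rw [setAverage_eq, smul_eq_mul, Real.dist_0_eq_abs, abs_of_nonneg
    (mul_nonneg (inv_nonneg.2 hm.le) (integral_nonneg fun _ => norm_nonneg _)),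
    inv_mul_lt_iff₀ hm, mul_comm]
  exact h4

/-- The conditional standard deviation is controlled by the conditional mean deviation from any
given value. -/
theorem setAverage_norm_sub_setAverage_sq_le {X F : Type*} [MeasurableSpace X]
    [NormedAddCommGroup F] [NormedSpace ℝ F] [CompleteSpace F] (μ : Measure X) [IsFiniteMeasure μ]
    {ψ : X → F} {v : F} {D : ℝ} (hψ : AEStronglyMeasurable ψ μ) (hD : ∀ x, ‖ψ x - v‖ ≤ D)
    {S : Set X} (hS : μ S ≠ 0) :
    ⨍ x in S, ‖ψ x - ⨍ z in S, ψ z ∂μ‖ ^ 2 ∂μ ≤ 4 * D * ⨍ x in S, ‖ψ x - v‖ ∂μ := by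
  set ν := (μ.restrict S Set.univ)⁻¹ • μ.restrict S with hν
  have hne : NeZero (μ.restrict S) := ⟨by simpa [Measure.restrict_eq_zero] using hS⟩
  have hprob : IsProbabilityMeasure ν := inferInstance
  have hsm : AEStronglyMeasurable ψ ν := (hψ.restrict).smul_measure _
  have hint1 : Integrable (fun x => ψ x - v) ν :=
    Integrable.of_bound (hsm.sub aestronglyMeasurable_const) D (ae_of_all _ hD)
  have hint : Integrable ψ ν :=
    (hint1.add (integrable_const v)).congr (ae_of_all _ fun x => by simp)
  simp only [average_eq']
  rw [← hν]
  set a := ∫ x, ‖ψ x - v‖ ∂ν with ha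
  have hmean : ‖v - ∫ z, ψ z ∂ν‖ ≤ a := by
    have : v - ∫ z, ψ z ∂ν = -∫ z, (ψ z - v) ∂ν := by
      rw [integral_sub hint (integrable_const v)]; simp
    rw [this, norm_neg]
    exact norm_integral_le_integral_norm _
  have haD : a ≤ D := by
    have := integral_mono hint1.norm (integrable_const D) hD
    simpa using this
  -- One factor of the square is bounded by `2 * D`, the other by `‖ψ x - v‖ + a`, whose mean is `2
  -- * a`.
  have hpt : ∀ x, ‖ψ x - ∫ z, ψ z ∂ν‖ ^ 2 ≤ 2 * D * (‖ψ x - v‖ + a) := fun x => by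
    have h1 : ‖ψ x - ∫ z, ψ z ∂ν‖ ≤ ‖ψ x - v‖ + a := by
      rw [← sub_add_sub_cancel (ψ x) v]
      exact (norm_add_le _ _).trans (add_le_add_right hmean _)
    have h2 : ‖ψ x - ∫ z, ψ z ∂ν‖ ≤ 2 * D := by linarith [hD x]
    nlinarith [norm_nonneg (ψ x - ∫ z, ψ z ∂ν)]
  calc ∫ x, ‖ψ x - ∫ z, ψ z ∂ν‖ ^ 2 ∂ν ≤ ∫ x, 2 * D * (‖ψ x - v‖ + a) ∂ν :=
        integral_mono_of_nonneg (ae_of_all _ fun _ => by positivity)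
          ((hint1.norm.add (integrable_const a)).const_mul _) (ae_of_all _ hpt)
    _ = 4 * D * a := by
        rw [integral_const_mul, integral_add hint1.norm (integrable_const a), ← ha]
        simp; ring

theorem continuous_delayMap {X : Type*} [TopologicalSpace X] {T : X → X} (hT : Continuous T)
    {h : X → ℝ} (hh : Continuous h) (k : ℕ) : Continuous (delayMap T h k) :=
  (PiLp.continuous_toLp 2 _).comp (continuous_pi fun i => hh.comp (hT.iterate i))

/-- If the delay vector of `T x` is a function of the delay vector of `x` on a set of full measure,
then the observable is almost surely predictable. -/
theorem almostSurelyPredictable_of_factors {X : Type*} [MetricSpace X] [CompactSpace X]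
    [MeasurableSpace X] [BorelSpace X] (μ : Measure X) [IsFiniteMeasure μ] {T : X → X}
    (hT : Continuous T) {h : X → ℝ} (hh : Continuous h) (k : ℕ) {A : Set X} (hA : MeasurableSet A)
    (hfull : μ Aᶜ = 0) (hfac : ∀ x ∈ A, ∀ y ∈ A, delayMap T h k x = delayMap T h k y →
      delayMap T h k (T x) = delayMap T h k (T y)) :
    AlmostSurelyPredictable μ T h k := by
  have hφ := continuous_delayMap hT hh k
  have hψ : Continuous fun x => delayMap T h k (T x) := hφ.comp hT
  obtain ⟨K, hmono, hK, hKA, hKnull⟩ := exists_monotone_isCompact_exhaustion μ hA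
  have hKm : ∀ n, MeasurableSet (K n) := fun n => (hK n).measurableSet
  have hKfull : μ (⋃ n, K n)ᶜ = 0 := by
    refine measure_mono_null (fun x hx => ?_) (measure_union_null hKnull hfull)
    by_cases hxA : x ∈ A
    · exact Or.inl ⟨hxA, hx⟩
    · exact Or.inr hxA
  -- Almost every `y` is `φ x₀` with `x₀` in some `K n ⊆ A`, so `hfac` compares `x₀` with the points
  -- of every `K m`. Images of compact sets keep this event measurable.
  have himage : ∀ᵐ y ∂(μ.map (delayMap T h k)), y ∈ ⋃ n, delayMap T h k '' K n := by
    refine (ae_map_iff hφ.aemeasurable (p := fun y => y ∈ ⋃ n, delayMap T h k '' K n)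
      (MeasurableSet.iUnion fun n => ((hK n).image hφ).isClosed.measurableSet)).2 ?_
    refine measure_mono_null (Set.compl_subset_compl.2 fun x hx' => ?_) hKfull
    obtain ⟨n, hn⟩ := Set.mem_iUnion.1 hx'
    exact Set.mem_iUnion.2 ⟨n, x, hn, rfl⟩
  filter_upwards [himage, Measure.support_mem_ae,
    ae_exists_eventually_measure_compl_le μ hφ.measurable hmono hKm hKfull] with y hy hys hdens
  obtain ⟨n, x₀, hx₀, rfl⟩ := Set.mem_iUnion.1 hy
  have hpos : ∀ r > 0, 0 < μ (delayMap T h k ⁻¹' Metric.ball (delayMap T h k x₀) r) :=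
    fun r hr => by
      have := (Measure.mem_support_iff_forall _).1 hys _ (Metric.ball_mem_nhds _ hr)
      rwa [Measure.map_apply hφ.measurable Metric.isOpen_ball.measurableSet] at this
  have hint : ∀ {F : Type} [NormedAddCommGroup F] [SecondCountableTopology F] {f : X → F},
      Continuous f → ∀ s : Set X, IntegrableOn f s μ := fun {F} _ _ {f} hf s => by
    obtain ⟨D, hD⟩ := (isCompact_range hf.norm).bddAbove
    exact (Integrable.of_bound hf.aestronglyMeasurable D
      (ae_of_all _ fun x => hD ⟨x, rfl⟩)).integrableOn
  refine ⟨hys, Eventually.of_forall fun ε => ⟨hint hψ _,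
    hint ((hψ.sub continuous_const).norm.pow 2) _⟩, ?_⟩
  have hmean := tendsto_setAverage_norm_sub μ hφ hψ hK hKm (x₀ := x₀)
    (fun m x hx he => hfac x (hKA m hx) x₀ (hKA n hx₀) he) hpos
    fun c hc => (hdens c hc).imp fun m hm => hm m le_rfl
  obtain ⟨D, hD⟩ := (isCompact_range
    (hψ.sub (continuous_const (y := delayMap T h k (T x₀)))).norm).bddAbove
  refine squeeze_zero' (Eventually.of_forall fun _ => Real.sqrt_nonneg _)
    (g := fun r => √(4 * D * ⨍ x in delayMap T h k ⁻¹' Metric.ball (delayMap T h k x₀) r,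
      ‖delayMap T h k (T x) - delayMap T h k (T x₀)‖ ∂μ)) ?_ ?_
  · filter_upwards [self_mem_nhdsWithin] with r hr
    exact Real.sqrt_le_sqrt (setAverage_norm_sub_setAverage_sq_le μ hψ.aestronglyMeasurable
      (fun x => hD ⟨x, rfl⟩) (hpos r hr).ne')
  · simpa using (hmean.const_mul (4 * D)).sqrt

/-! ### Linear dependence of delay differences. -/

/-- Linear relations between the functionals `f ↦ f (T^i x) - f (T^i y)`, `i < k`, propagate: if
these functionals are linearly dependent and vanish at `h`, then all the later ones vanish at `h`. -/
theorem iterate_eq_of_dependent {X : Type*} {T : X → X} {x y : X} {k : ℕ} {c : Fin k → ℝ}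
    (hc : c ≠ 0) (hdep : ∀ f : X → ℝ, ∑ i, c i * (f (T^[i] x) - f (T^[i] y)) = 0) {h : X → ℝ}
    (heq : ∀ i < k, h (T^[i] x) = h (T^[i] y)) (n : ℕ) : h (T^[n] x) = h (T^[n] y) := by
  -- Solving for the last nonzero coefficient turns the relation into a recurrence.
  obtain ⟨i₀, hi₀, hmax⟩ : ∃ i₀, c i₀ ≠ 0 ∧ ∀ i, i₀ < i → c i = 0 := by
    have hne : (Finset.univ.filter fun i => c i ≠ 0).Nonempty := by
      obtain ⟨i, hi⟩ := Function.ne_iff.1 hc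
      exact ⟨i, by simpa using hi⟩
    refine ⟨Finset.max' _ hne, by simpa using Finset.max'_mem _ hne, fun i hi => ?_⟩
    by_contra hcon
    exact absurd (Finset.le_max' _ i (by simpa using hcon)) (not_le.2 hi)
  induction n using Nat.strong_induction_on with
  | _ n ih =>
    rcases lt_or_ge n k with hn | hn
    · exact heq n hn
    have hin : (i₀ : ℕ) ≤ n := i₀.2.le.trans hn
    -- Testing on `h ∘ T^[n - i₀]` moves the leading term to time `n`; the other nonzero terms have
    -- earlier times.
    have hsum := hdep fun z => h (T^[n - i₀] z)
    rw [Finset.sum_eq_single i₀] at hsum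
    · rw [← Function.iterate_add_apply, ← Function.iterate_add_apply, Nat.sub_add_cancel hin] at hsum
      exact sub_eq_zero.1 ((mul_eq_zero.1 hsum).resolve_left hi₀)
    · intro i _ hi
      rcases lt_or_gt_of_ne hi with hlt | hgt
      · rw [← Function.iterate_add_apply, ← Function.iterate_add_apply,
          ih _ (by have : (i : ℕ) < i₀ := hlt; omega), sub_self, mul_zero]
      · rw [hmax i hgt, zero_mul]
    · simp

/-- A linear map to `ℝ^k` that is not onto has a linear relation between its components. -/
theorem LinearMap.exists_sum_eq_zero_of_not_surjective {G : Type*} [AddCommGroup G] [Module ℝ G]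
    {k : ℕ} (A : G →ₗ[ℝ] (Fin k → ℝ)) (hA : ¬ Function.Surjective A) :
    ∃ c : Fin k → ℝ, c ≠ 0 ∧ ∀ a, ∑ i, c i * A a i = 0 := by
  obtain ⟨f, hf, hle⟩ := Submodule.exists_le_ker_of_lt_top _
    (lt_top_iff_ne_top.2 (mt LinearMap.range_eq_top.1 hA))
  refine ⟨fun i => f (Pi.single i 1), fun h0 => hf ?_, fun a => ?_⟩
  · refine LinearMap.pi_ext' fun i => LinearMap.ext_ring ?_
    simpa using congrFun h0 i
  · have h1 : f (A a) = 0 := hle ⟨a, rfl⟩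
    rw [LinearMap.pi_apply_eq_sum_univ f (A a)] at h1
    rw [← h1]
    refine Finset.sum_congr rfl fun i _ => ?_
    have e : (fun j => if i = j then 1 else 0) = (Pi.single i 1 : Fin k → ℝ) := by
      ext j
      simp [Pi.single_apply, eq_comm]
    rw [smul_eq_mul, mul_comm, e]

/-! ### Polynomial perturbations and their effect on delay differences. -/

namespace LipSpace

section Eval

variable {X : Type*} [MetricSpace X]

theorem continuous (h : LipSpace X) : Continuous h := by
  obtain ⟨K, hK⟩ := h.lipschitz
  exact hK.continuous

variable [CompactSpace X]

/-- Evaluation at a point. -/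
noncomputable def evalCLM (x : X) : LipSpace X →L[ℝ] ℝ :=
  LinearMap.mkContinuous
    { toFun := fun h => h x
      map_add' := fun _ _ => rfl
      map_smul' := fun _ _ => rfl } 1
    fun h => (h.abs_le_norm x).trans_eq (one_mul _).symm

@[simp] theorem evalCLM_apply (x : X) (h : LipSpace X) : evalCLM x h = h x := rfl

theorem continuous_eval : Continuous fun p : LipSpace X × X => p.1 p.2 := by
  refine continuous_iff_continuousAt.2 fun ⟨h, x⟩ => ?_
  refine tendsto_iff_dist_tendsto_zero.2 ?_
  refine squeeze_zero (fun _ => dist_nonneg)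
    (g := fun p : LipSpace X × X => ‖p.1 - h‖ + dist (h p.2) (h x)) (fun p => ?_) ?_
  · refine (dist_triangle _ (h p.2) _).trans (add_le_add_left ?_ _)
    exact (p.1 - h).abs_le_norm p.2
  · have : Continuous fun p : LipSpace X × X => ‖p.1 - h‖ + dist (h p.2) (h x) :=
      ((continuous_fst.sub continuous_const).norm).add
        ((h.continuous.comp continuous_snd).dist continuous_const)
    simpa using this.tendsto (h, x)

theorem mul_mem {f g : X → ℝ} (hf : f ∈ lipSubmodule X) (hg : g ∈ lipSubmodule X) :
    f * g ∈ lipSubmodule X := by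
  set F : LipSpace X := ⟨f, hf⟩ with hF
  set G : LipSpace X := ⟨g, hg⟩ with hG
  refine ⟨(‖F‖ * ‖G‖ + ‖F‖ * ‖G‖).toNNReal, LipschitzWith.of_dist_le_mul fun x y => ?_⟩
  rw [Real.coe_toNNReal _ (by positivity), Real.dist_eq]
  have e : (f * g) x - (f * g) y = F x * (G x - G y) + (F x - F y) * G y := by
    simp [hF, hG]; ring
  rw [e]
  refine (abs_add_le _ _).trans ?_
  rw [abs_mul, abs_mul, add_mul]
  have h1 := mul_le_mul (F.abs_le_norm x) (G.abs_sub_le_norm x y) (abs_nonneg _) (norm_nonneg _)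
  have h2 := mul_le_mul (F.abs_sub_le_norm x y) (G.abs_le_norm y) (abs_nonneg _) (by positivity)
  linarith

end Eval

section Probe

variable {N : ℕ} {X : Set (EuclideanSpace ℝ (Fin N))} {ι : Type*} [Fintype ι]

/-- The affine coordinates of a point: the constant `1` and its coordinates. -/
def affineCoord (x : X) : Option (Fin N) → ℝ
  | none => 1
  | some l => x.1 l

theorem affineCoord_mem (o : Option (Fin N)) : (fun x : X => affineCoord x o) ∈ lipSubmodule X := by
  cases o with
  | none => exact ⟨0, LipschitzWith.const 1⟩
  | some l =>
    refine ⟨1, LipschitzWith.of_dist_le_mul fun x y => ?_⟩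
    rw [NNReal.coe_one, one_mul, Subtype.dist_eq, dist_eq_norm, dist_eq_norm]
    exact PiLp.norm_apply_le (x.1 - y.1) l

variable [CompactSpace X]

/-- The monomial of degree at most `card ι` in the coordinates, as a Lipschitz function. -/
noncomputable def monomialProbe (J : ι → Option (Fin N)) : LipSpace X :=
  ⟨fun x => ∏ i, affineCoord x (J i), by
    have := Finset.prod_induction (s := Finset.univ) (fun i => fun x : X => affineCoord x (J i))
      (· ∈ lipSubmodule X) (fun _ _ => mul_mem) ⟨0, LipschitzWith.const 1⟩
      fun i _ => affineCoord_mem (J i)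
    rwa [Finset.prod_fn] at this⟩

variable (X ι) in
/-- The polynomial with given coefficients, as a Lipschitz function. -/
noncomputable def polyProbe [DecidableEq ι] : ((ι → Option (Fin N)) → ℝ) →L[ℝ] LipSpace X :=
  (Fintype.linearCombination ℝ (monomialProbe (X := X))).toContinuousLinearMap

variable [DecidableEq ι]

theorem polyProbe_apply (a : (ι → Option (Fin N)) → ℝ) (x : X) :
    polyProbe X ι a x = ∑ J, a J * ∏ i, affineCoord x (J i) := by
  rw [← evalCLM_apply]
  simp only [polyProbe, LinearMap.coe_toContinuousLinearMap', Fintype.linearCombination_apply,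
    map_sum, map_smul, smul_eq_mul, evalCLM_apply]
  rfl

/-- A product of `card ι` affine functions is a polynomial. -/
theorem exists_polyProbe_eq_prod (b : ι → Option (Fin N) → ℝ) :
    ∃ a, ∀ x : X, polyProbe X ι a x = ∏ i, ∑ o, b i o * affineCoord x o := by
  refine ⟨fun J => ∏ i, b i (J i), fun x => ?_⟩
  rw [polyProbe_apply, Finset.prod_univ_sum, Fintype.piFinset_univ]
  exact Finset.sum_congr rfl fun J _ => Finset.prod_mul_distrib.symm

open scoped RealInnerProductSpace in
/-- Polynomials of degree at most `card ι` separate a point of a family indexed by `ι` from the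
other ones. -/
theorem exists_polyProbe_eq_ite (P : ι → X) (s : X) :
    ∃ a, ∀ i, polyProbe X ι a (P i) = if P i = s then 1 else 0 := by
  classical
  let w : ι → EuclideanSpace ℝ (Fin N) := fun i => s.1 - (P i).1
  -- Lagrange interpolation: the factor for `P i ≠ s` is the affine function in direction `s - P i`
  -- with value `0` at `P i` and `1` at `s`.
  let b : ι → Option (Fin N) → ℝ := fun i o =>
    if P i = s then (match o with | none => 1 | some _ => 0)
    else (match o with | none => -(⟪w i, (P i).1⟫ / ⟪w i, w i⟫) | some l => w i l / ⟪w i, w i⟫)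
  have hb : ∀ i (x : X), ∑ o, b i o * affineCoord x o =
      if P i = s then 1 else ⟪w i, x.1 - (P i).1⟫ / ⟪w i, w i⟫ := fun i x => by
    rw [Fintype.sum_option]
    by_cases h : P i = s
    · simp [b, h, affineCoord]
    · simp only [b, h, affineCoord, if_false, mul_one, inner_sub_right, sub_div, div_mul_eq_mul_div]
      rw [← Finset.sum_div, sub_eq_neg_add]
      congr 2
      simp [PiLp.inner_apply, mul_comm]
  obtain ⟨a, ha⟩ := exists_polyProbe_eq_prod (X := X) b
  refine ⟨a, fun j => ?_⟩
  rw [ha]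
  simp only [hb]
  split_ifs with h
  · refine Finset.prod_eq_one fun i _ => ?_
    split_ifs with h'
    · rfl
    · rw [h]
      refine div_self (inner_self_ne_zero.2 (sub_ne_zero.2 fun e => h' (Subtype.ext e.symm)))
  · refine Finset.prod_eq_zero (Finset.mem_univ j) ?_
    simp [h]

/-- Polynomials of degree at most `card ι` interpolate any function at `card ι` points. -/
theorem exists_polyProbe_eq (P : ι → X) (f : X → ℝ) :
    ∃ a, ∀ i, polyProbe X ι a (P i) = f (P i) := by
  classical
  choose a ha using exists_polyProbe_eq_ite P
  -- The sum runs over the image of `P`: orbit points may coincide, and each must count once.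
  refine ⟨∑ s ∈ Finset.univ.image P, f s • a s, fun i => ?_⟩
  rw [← evalCLM_apply]
  simp only [map_sum, map_smul, evalCLM_apply, ha, smul_eq_mul, mul_ite, mul_one, mul_zero]
  rw [Finset.sum_ite_eq, if_pos (Finset.mem_image_of_mem P (Finset.mem_univ i))]

end Probe

section DelayDiff

variable {X : Type*} [MetricSpace X] [CompactSpace X]

/-- The differences of the `k` delay coordinates at `x` and `y`, as a function of the observable. -/
noncomputable def delayDiff (T : X → X) (k : ℕ) (x y : X) : LipSpace X →L[ℝ] (Fin k → ℝ) :=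
  ContinuousLinearMap.pi fun i => evalCLM (T^[i] x) - evalCLM (T^[i] y)

theorem delayDiff_apply (T : X → X) (k : ℕ) (x y : X) (h : LipSpace X) (i : Fin k) :
    delayDiff T k x y h i = h (T^[i] x) - h (T^[i] y) := rfl

theorem delayDiff_eq_zero {T : X → X} {k : ℕ} {x y : X} {h : LipSpace X} :
    delayDiff T k x y h = 0 ↔ ∀ i < k, h (T^[i] x) = h (T^[i] y) := by
  simp only [funext_iff, delayDiff_apply, Pi.zero_apply, sub_eq_zero]
  exact ⟨fun H i hi => H ⟨i, hi⟩, fun H i => H i i.2⟩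

/-- `delayDiff` is Lipschitz in its second point. -/
theorem exists_norm_delayDiff_sub_le {T : X → X} {K : ℝ≥0} (hT : LipschitzWith K T) (k : ℕ) :
    ∃ C : ℝ≥0, ∀ x y y' : X, ∀ h : LipSpace X,
      ‖delayDiff T k x y h - delayDiff T k x y' h‖ ≤ C * ‖h‖ * dist y y' := by
  refine ⟨∑ i : Fin k, K ^ (i : ℕ), fun x y y' h => (pi_norm_le_iff_of_nonneg (by positivity)).2
    fun i => ?_⟩
  rw [Pi.sub_apply, delayDiff_apply, delayDiff_apply, sub_sub_sub_cancel_left, norm_sub_rev]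
  refine (h.abs_sub_le_norm _ _).trans ?_
  rw [mul_comm _ ‖h‖, mul_assoc]
  refine mul_le_mul_of_nonneg_left (((hT.iterate i).dist_le_mul y y').trans ?_) (norm_nonneg _)
  refine mul_le_mul_of_nonneg_right ?_ dist_nonneg
  exact_mod_cast Finset.single_le_sum (f := fun i : Fin k => K ^ (i : ℕ)) (fun _ _ => zero_le)
    (Finset.mem_univ i)

end DelayDiff

/-- If the first `k` delay coordinates of `x` and `y` agree and a later one does not, then they can
be perturbed independently by polynomials. -/
theorem surjective_delayDiff_comp_polyProbe {N : ℕ} {X : Set (EuclideanSpace ℝ (Fin N))}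
    [CompactSpace X] {T : X → X} {k n : ℕ} {x y : X} {h : X → ℝ}
    (heq : ∀ i < k, h (T^[i] x) = h (T^[i] y)) (hne : h (T^[n] x) ≠ h (T^[n] y)) :
    Function.Surjective (delayDiff T k x y ∘L polyProbe X (Fin k ⊕ Fin k)) := by
  by_contra hcon
  obtain ⟨c, hc, hsum⟩ := LinearMap.exists_sum_eq_zero_of_not_surjective
    (delayDiff T k x y ∘L polyProbe X (Fin k ⊕ Fin k)).toLinearMap hcon
  refine hne (iterate_eq_of_dependent hc (fun f => ?_) heq n)
  -- The relation sees `f` only at these `2k` points, so a relation valid for polynomials holds for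
  -- every function.
  obtain ⟨a, ha⟩ := exists_polyProbe_eq (X := X)
    (Sum.elim (fun i : Fin k => T^[i] x) (fun i : Fin k => T^[i] y)) f
  rw [← hsum a]
  refine Finset.sum_congr rfl fun i _ => ?_
  have h1 := ha (Sum.inl i)
  have h2 := ha (Sum.inr i)
  simp only [Sum.elim_inl, Sum.elim_inr] at h1 h2
  rw [← h1, ← h2]
  rfl

end LipSpace

/-! ### Parametric transversality. -/

section Transversality

variable {X : Type*} [MetricSpace X] [CompactSpace X] {k : ℕ} {G : Type*} [NormedAddCommGroup G]
  [NormedSpace ℝ G]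

/-- The zeros of affine maps that depend on a parameter in a Lipschitz way and expand uniformly
form a null set, if the dimension of the set of parameters is small. -/
theorem volume_setOf_exists_affine_eq_zero {C : Set X} (hdim : dimH C < k)
    {M : X → (Fin k → ℝ) →L[ℝ] (Fin k → ℝ)} {KM : ℝ≥0} (hM : LipschitzWith KM M)
    {b : X → Fin k → ℝ} {Kb : ℝ≥0} (hb : LipschitzWith Kb b) :
    volume {γ : Fin k → ℝ | ∃ y ∈ C, (∀ v, ‖v‖ ≤ 2 * ‖M y v‖) ∧ M y γ + b y = 0} = 0 := by
  set S := {γ : Fin k → ℝ | ∃ y ∈ C, (∀ v, ‖v‖ ≤ 2 * ‖M y v‖) ∧ M y γ + b y = 0} with hS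
  set Z := {y ∈ C | (∀ v, ‖v‖ ≤ 2 * ‖M y v‖) ∧ ∃ γ, M y γ + b y = 0} with hZ
  have hex : ∀ y, ∃ γ, y ∈ Z → M y γ + b y = 0 := fun y => by
    by_cases h : y ∈ Z
    · obtain ⟨γ, hγ⟩ := h.2.2
      exact ⟨γ, fun _ => hγ⟩
    · exact ⟨0, fun h' => absurd h' h⟩
  choose F hF using hex
  obtain ⟨R, hR⟩ := (isCompact_range hb.continuous.norm).bddAbove
  replace hR : ∀ y, ‖b y‖ ≤ R := fun y => hR ⟨y, rfl⟩
  have hFR : ∀ y ∈ Z, ‖F y‖ ≤ 2 * R := fun y hy => by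
    refine (hy.2.1 (F y)).trans ?_
    rw [eq_neg_of_add_eq_zero_left (hF y hy), norm_neg]
    linarith [hR y]
  have hlip : LipschitzOnWith (2 * (Kb + KM * (2 * R).toNNReal)) F Z := by
    refine LipschitzOnWith.of_dist_le_mul fun y hy z hz => ?_
    have hR0 : 0 ≤ 2 * R := (norm_nonneg _).trans (hFR z hz)
    -- Subtracting the equations at `y` and `z`: since `M y` expands, the zero `F y` is a Lipschitz
    -- function of `y`.
    have e : M y (F y - F z) = (b z - b y) + (M z - M y) (F z) := by
      rw [map_sub, sub_apply, eq_neg_of_add_eq_zero_left (hF y hy),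
        eq_neg_of_add_eq_zero_left (hF z hz)]
      abel
    have h1 : ‖b z - b y‖ ≤ Kb * dist y z := by
      rw [← dist_eq_norm, dist_comm]; exact hb.dist_le_mul y z
    have h2 : ‖M z - M y‖ ≤ KM * dist y z := by
      rw [← dist_eq_norm, dist_comm]; exact hM.dist_le_mul y z
    have h3 : ‖(M z - M y) (F z)‖ ≤ KM * dist y z * (2 * R) :=
      ((M z - M y).le_opNorm _).trans (mul_le_mul h2 (hFR z hz) (norm_nonneg _) (by positivity))
    have h4 := hy.2.1 (F y - F z)
    rw [e] at h4
    have h5 := norm_add_le (b z - b y) ((M z - M y) (F z))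
    rw [dist_eq_norm]
    push_cast
    rw [Real.coe_toNNReal _ hR0]
    nlinarith
  have hsub : S ⊆ F '' Z := by
    rintro γ ⟨y, hy, hexp, h0⟩
    have hyZ : y ∈ Z := ⟨hy, hexp, γ, h0⟩
    refine ⟨y, hyZ, ?_⟩
    have h1 := hexp (F y - γ)
    rw [map_sub, eq_neg_of_add_eq_zero_left (hF y hyZ), eq_neg_of_add_eq_zero_left h0, sub_self,
      norm_zero, mul_zero] at h1
    exact sub_eq_zero.1 (norm_le_zero_iff.1 h1)
  have hdimS : dimH S < ((k : ℝ≥0) : ℝ≥0∞) := by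
    refine ((dimH_mono hsub).trans (hlip.dimH_image_le.trans
      (dimH_mono (Set.sep_subset _ _)))).trans_lt ?_
    simpa using hdim
  have h0 := hausdorffMeasure_of_dimH_lt hdimS
  -- For the sup metric on `Fin k → ℝ`, Lebesgue measure is the `k`-dimensional Hausdorff measure.
  have hv := hausdorffMeasure_pi_real (ι := Fin k)
  rw [Fintype.card_fin] at hv
  rw [← hv]
  simpa using h0

variable [FiniteDimensional ℝ G] [MeasurableSpace G] [BorelSpace G]

/-- A parametric transversality theorem: if the affine maps `a ↦ A y a + b y` to `ℝ^k` depend on `y`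
in a Lipschitz way, then almost no `a` is a zero of one that is onto and has its parameter in a
given compact set of dimension less than `k`. -/
theorem measure_setOf_exists_surjective_eq_zero (ν : Measure G) [ν.IsAddHaarMeasure] {C : Set X}
    (hC : IsCompact C) (hdim : dimH C < k) {A : X → G →L[ℝ] (Fin k → ℝ)} {KA : ℝ≥0}
    (hA : LipschitzWith KA A) {b : X → Fin k → ℝ} {Kb : ℝ≥0} (hb : LipschitzWith Kb b) :
    ν {a | ∃ y ∈ C, Function.Surjective (A y) ∧ A y a + b y = 0} = 0 := by
  -- Some `L n` is close to a right inverse of `A y`, so `A y ∘ L n` is within `1 / 2` of the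
  -- identity. This gives the factor `2` and reduces to countably many cases with uniform expansion.
  set L := TopologicalSpace.denseSeq ((Fin k → ℝ) →L[ℝ] G) with hL
  set bad : ℕ → Set G := fun n =>
    {a | ∃ y ∈ C, (∀ v, ‖v‖ ≤ 2 * ‖A y (L n v)‖) ∧ A y a + b y = 0} with hbad
  have hcover : {a | ∃ y ∈ C, Function.Surjective (A y) ∧ A y a + b y = 0} ⊆ ⋃ n, bad n := by
    rintro a ⟨y, hy, hsurj, h0⟩
    obtain ⟨g, hg⟩ := (A y).toLinearMap.exists_rightInverse_of_surjective
      (LinearMap.range_eq_top.2 hsurj)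
    set R := LinearMap.toContinuousLinearMap g
    have hR : ∀ v, A y (R v) = v := fun v => LinearMap.congr_fun hg v
    have hε : 0 < 1 / (2 * (‖A y‖ + 1)) := by positivity
    obtain ⟨n, hn⟩ := (TopologicalSpace.denseRange_denseSeq _).exists_dist_lt R hε
    refine Set.mem_iUnion.2 ⟨n, y, hy, fun v => ?_, h0⟩
    rw [dist_eq_norm] at hn
    have h1 : ‖A y ((R - L n) v)‖ ≤ 1 / 2 * ‖v‖ := by
      refine ((A y).le_opNorm _).trans ?_
      have h2 := mul_le_mul_of_nonneg_left (((R - L n).le_opNorm v).trans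
        (mul_le_mul_of_nonneg_right hn.le (norm_nonneg v))) (norm_nonneg (A y))
      refine h2.trans ?_
      rw [← mul_assoc]
      refine mul_le_mul_of_nonneg_right ?_ (norm_nonneg v)
      rw [mul_one_div, div_le_div_iff₀ (by positivity) (by positivity)]
      linarith
    rw [sub_apply, map_sub, hR] at h1
    have h3 := norm_add_le (v - A y (L n v)) (A y (L n v))
    rw [sub_add_cancel] at h3
    linarith
  refine measure_mono_null hcover (measure_iUnion_null fun n => ?_)
  have hclosed : IsClosed (bad n) := by
    have hcl : IsClosed {p : G × X | p.2 ∈ C ∧ (p ∈ ⋂ v, {p | ‖v‖ ≤ 2 * ‖A p.2 (L n v)‖}) ∧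
        A p.2 p.1 + b p.2 = 0} := by
      have hAc : Continuous fun p : G × X => A p.2 := hA.continuous.comp continuous_snd
      refine (hC.isClosed.preimage continuous_snd).inter (IsClosed.inter ?_ ?_)
      · exact isClosed_iInter fun v => isClosed_le continuous_const
          (continuous_const.mul (hAc.clm_apply continuous_const).norm)
      · exact isClosed_eq ((hAc.clm_apply continuous_fst).add (hb.continuous.comp continuous_snd))
          continuous_const
    convert isClosedMap_fst_of_compactSpace _ hcl using 1
    ext a
    simp [hbad]
  have hae : ∀ᵐ a ∂ν, a ∈ (bad n)ᶜ := by
    -- Fubini along translates of the range of `L n`: each slice through `β` is a `k`-dimensional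
    -- problem.
    refine (ae_ae_add_linearMap_mem_iff (L n).toLinearMap (volume : Measure (Fin k → ℝ)) ν
      hclosed.measurableSet.compl).1 (ae_of_all _ fun β => ?_)
    have hM : LipschitzWith (KA * ‖L n‖₊) fun y => A y ∘L L n := by
      refine LipschitzWith.of_dist_le_mul fun y z => ?_
      rw [dist_eq_norm, ← ContinuousLinearMap.sub_comp]
      refine (ContinuousLinearMap.opNorm_comp_le _ _).trans ?_
      rw [← dist_eq_norm, NNReal.coe_mul, coe_nnnorm, mul_right_comm]
      exact mul_le_mul_of_nonneg_right (hA.dist_le_mul y z) (norm_nonneg _)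
    have hb' : LipschitzWith (KA * ‖β‖₊ + Kb) fun y => A y β + b y := by
      refine LipschitzWith.add (LipschitzWith.of_dist_le_mul fun y z => ?_) hb
      rw [dist_eq_norm, ← sub_apply]
      refine ((A y - A z).le_opNorm β).trans ?_
      rw [← dist_eq_norm, NNReal.coe_mul, coe_nnnorm, mul_right_comm]
      exact mul_le_mul_of_nonneg_right (hA.dist_le_mul y z) (norm_nonneg _)
    refine measure_mono_null (fun γ hγ => ?_) (volume_setOf_exists_affine_eq_zero hdim hM hb')
    obtain ⟨y, hy, hexp, h0⟩ := not_not.1 hγ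
    refine ⟨y, hy, hexp, ?_⟩
    rw [← h0, map_add, ContinuousLinearMap.comp_apply, ContinuousLinearMap.coe_coe]
    abel
  simpa [ae_iff] using hae

end Transversality

/-! ### Collisions of delay vectors. -/

namespace LipSpace

section Collision

variable {X : Type*} [MetricSpace X] [CompactSpace X]

/-- The pairs `(h, x)` such that some `y ∈ C` has the same first `k` delay coordinates as `x`, but
the delay coordinate number `j` of `x` and `y` differs by at least `δ`. -/
def collisionSet (T : X → X) (C : Set X) (k j : ℕ) (δ : ℝ) : Set (LipSpace X × X) :=
  {p | ∃ y ∈ C, (∀ i < k, p.1 (T^[i] p.2) = p.1 (T^[i] y)) ∧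
    δ ≤ |p.1 (T^[j] p.2) - p.1 (T^[j] y)|}

/-- The threshold `δ` replaces the open condition `≠` by a closed one, and projecting out `y` along
the compact space `X` preserves closedness. -/
theorem isClosed_collisionSet {T : X → X} (hT : Continuous T) {C : Set X} (hC : IsCompact C)
    (k j : ℕ) (δ : ℝ) : IsClosed (collisionSet T C k j δ) := by
  have hx : ∀ i, Continuous fun q : (LipSpace X × X) × X => q.1.1 (T^[i] q.1.2) := fun i =>
    continuous_eval.comp ((continuous_fst.comp continuous_fst).prodMk
      ((hT.iterate i).comp (continuous_snd.comp continuous_fst)))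
  have hy : ∀ i, Continuous fun q : (LipSpace X × X) × X => q.1.1 (T^[i] q.2) := fun i =>
    continuous_eval.comp ((continuous_fst.comp continuous_fst).prodMk
      ((hT.iterate i).comp continuous_snd))
  have hcl : IsClosed {q : (LipSpace X × X) × X | q.2 ∈ C ∧
      (q ∈ ⋂ i, ⋂ _ : i < k, {q | q.1.1 (T^[i] q.1.2) = q.1.1 (T^[i] q.2)}) ∧
      δ ≤ |q.1.1 (T^[j] q.1.2) - q.1.1 (T^[j] q.2)|} :=
    (hC.isClosed.preimage continuous_snd).inter
      ((isClosed_iInter fun i => isClosed_iInter fun _ => isClosed_eq (hx i) (hy i)).inter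
        (isClosed_le continuous_const ((hx j).sub (hy j)).abs))
  convert isClosedMap_fst_of_compactSpace _ hcl using 1
  ext p
  simp [collisionSet]

variable [MeasurableSpace X] [BorelSpace X]

/-- The observables for which almost no point lies in a collision with a point of the compact sets
`C n`. -/
def collisionFree (μ : Measure X) (T : X → X) (C : ℕ → Set X) (k : ℕ) : Set (LipSpace X) :=
  {h | ∀ n j m : ℕ, μ {x | (h, x) ∈ collisionSet T (C n) k j (1 / (m + 1))} = 0}

/-- The measure of a section of a closed set is a measurable function of `h`. `Lip(X)` may be
nonseparable, but second countability of `X` makes the closed set measurable for the product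
σ-algebra. -/
theorem measurableSet_collisionFree (μ : Measure X) [IsFiniteMeasure μ] {T : X → X}
    (hT : Continuous T) {C : ℕ → Set X} (hC : ∀ n, IsCompact (C n)) (k : ℕ) :
    MeasurableSet (collisionFree μ T C k) := by
  have hrw : collisionFree μ T C k = ⋂ n : ℕ, ⋂ j : ℕ, ⋂ m : ℕ,
      {h | μ (Prod.mk h ⁻¹' collisionSet T (C n) k j (1 / (m + 1))) = 0} := by
    ext h
    simp only [Set.mem_iInter]
    rfl
  rw [hrw]
  refine MeasurableSet.iInter fun n => MeasurableSet.iInter fun j => MeasurableSet.iInter fun m => ?_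
  exact measurable_measure_prodMk_left (isClosed_collisionSet hT (hC n) k j _).measurableSet
    (measurableSet_singleton 0)

/-- Agreement of `l ≥ k` coordinates contains agreement of `k`, so excluding collisions for one `k`
settles all larger ones. -/
theorem almostSurelyPredictable_of_mem_collisionFree (μ : Measure X) [IsFiniteMeasure μ] {T : X → X}
    (hT : Continuous T) {C : ℕ → Set X} (hC : ∀ n, IsCompact (C n)) (hfull : μ (⋃ n, C n)ᶜ = 0)
    {k l : ℕ} (hkl : k ≤ l) {h : LipSpace X} (hh : h ∈ collisionFree μ T C k) :
    AlmostSurelyPredictable μ T h l := by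
  set W : ℕ → ℕ → ℕ → Set X := fun n j m =>
    {x | (h, x) ∈ collisionSet T (C n) k j (1 / (m + 1))} with hW
  have hWm : ∀ n j m, MeasurableSet (W n j m) := fun n j m =>
    ((isClosed_collisionSet hT (hC n) k j _).preimage
      (Continuous.prodMk_right h)).measurableSet
  have hW0 : μ (⋃ n, ⋃ j, ⋃ m, W n j m) = 0 :=
    measure_iUnion_null fun n => measure_iUnion_null fun j => measure_iUnion_null fun m => hh n j m
  refine almostSurelyPredictable_of_factors μ hT h.continuous l
    (A := (⋃ n, C n) \ ⋃ n, ⋃ j, ⋃ m, W n j m) ?_ ?_ fun x hx y hy hxy => ?_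
  · exact (MeasurableSet.iUnion fun n => (hC n).measurableSet).diff
      (MeasurableSet.iUnion fun n => MeasurableSet.iUnion fun j => MeasurableSet.iUnion fun m =>
        hWm n j m)
  · rw [Set.sdiff_eq, Set.compl_inter, compl_compl]
    exact measure_union_null hfull hW0
  · have hcoord : ∀ i < l, h (T^[i] x) = h (T^[i] y) := fun i hi =>
      congrArg (fun v : EuclideanSpace ℝ (Fin l) => v ⟨i, hi⟩) hxy
    have hall : ∀ j, h (T^[j] x) = h (T^[j] y) := fun j => by
      by_contra hne
      obtain ⟨m, hm⟩ := exists_nat_one_div_lt (abs_pos.2 (sub_ne_zero.2 hne))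
      obtain ⟨n, hn⟩ := Set.mem_iUnion.1 hy.1
      refine hx.2 (Set.mem_iUnion.2 ⟨n, Set.mem_iUnion.2 ⟨j, Set.mem_iUnion.2 ⟨m, y, hn, ?_, hm.le⟩⟩⟩)
      exact fun i hi => hcoord i (hi.trans_le hkl)
    -- For `i = l - 1` this is coordinate number `l`, the only one not already contained in `hxy`.
    ext i
    exact hall (i + 1)

end Collision

/-! ### Fubini and the probe measure. -/

section Prevalent

variable {N : ℕ} {X : Set (EuclideanSpace ℝ (Fin N))} [CompactSpace X]

/-- For almost every polynomial perturbation, almost no point lies in a collision. -/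
theorem ae_add_polyProbe_mem_collisionFree (μ : Measure X) [IsFiniteMeasure μ] {T : X → X} {K : ℝ≥0}
    (hT : LipschitzWith K T) {C : ℕ → Set X} (hC : ∀ n, IsCompact (C n)) {k : ℕ}
    (hdim : ∀ n, dimH (C n) < k) (v : LipSpace X) :
    ∀ᵐ a, v + polyProbe X (Fin k ⊕ Fin k) a ∈ collisionFree μ T C k := by
  set Φ := polyProbe X (Fin k ⊕ Fin k) with hΦ
  refine ae_all_iff.2 fun n => ae_all_iff.2 fun j => ae_all_iff.2 fun m => ?_
  set W := collisionSet T (C n) k j (1 / (m + 1)) with hW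
  have hWcl : IsClosed W := isClosed_collisionSet hT.continuous (hC n) k j _
  have hmeas : MeasurableSet {p : X × ((Fin k ⊕ Fin k → Option (Fin N)) → ℝ) |
      (v + Φ p.2, p.1) ∉ W} :=
    (hWcl.preimage ((continuous_const.add (Φ.continuous.comp continuous_snd)).prodMk
      continuous_fst)).measurableSet.compl
  have hae : ∀ᵐ x ∂μ, ∀ᵐ a, (v + Φ a, x) ∉ W := by
    refine ae_of_all _ fun x => ?_
    obtain ⟨D, hD⟩ := exists_norm_delayDiff_sub_le (X := X) hT k
    have hA : LipschitzWith (D * ‖Φ‖₊) fun y => delayDiff T k x y ∘L Φ := by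
      refine LipschitzWith.of_dist_le_mul fun y z => ?_
      rw [dist_eq_norm]
      refine ContinuousLinearMap.opNorm_le_bound _ (by positivity) fun a => ?_
      refine (hD x y z (Φ a)).trans ?_
      rw [NNReal.coe_mul, coe_nnnorm, mul_right_comm _ (dist y z), mul_assoc (D : ℝ) ‖Φ‖]
      gcongr
      exact Φ.le_opNorm a
    have hb : LipschitzWith (D * ‖v‖₊) fun y => delayDiff T k x y v :=
      LipschitzWith.of_dist_le_mul fun y z => by
        rw [dist_eq_norm]
        exact hD x y z v
    refine measure_mono_null (fun a ha => ?_)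
      (measure_setOf_exists_surjective_eq_zero volume (hC n) (hdim n) hA hb)
    obtain ⟨y, hy, heq, hδ⟩ := not_not.1 ha
    -- Surjectivity comes from the collision itself, for the perturbed observable; pairs `y` where
    -- it fails never collide.
    refine ⟨y, hy, surjective_delayDiff_comp_polyProbe (n := j) heq fun h0 => ?_, ?_⟩
    · have : (0 : ℝ) < 1 / (m + 1) := by positivity
      have h1 := this.trans_le hδ
      simp only at h1 h0
      rw [h0, sub_self, abs_zero] at h1
      exact lt_irrefl _ h1
    · rw [ContinuousLinearMap.comp_apply, ← map_add, add_comm]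
      exact delayDiff_eq_zero.2 heq
  -- Exchange of the quantifiers over `x` and the coefficients `a`.
  filter_upwards [(Measure.ae_ae_comm hmeas).1 hae] with a ha
  exact measure_eq_zero_iff_ae_notMem.2 ha

/-- The probe is the image of Lebesgue measure on the unit ball of coefficients. Restricting to the
ball keeps it finite, even where `Φ` is not injective. -/
theorem isPrevalent_of_collisionFree_subset (μ : Measure X) [IsFiniteMeasure μ] {T : X → X}
    {K : ℝ≥0} (hT : LipschitzWith K T) {C : ℕ → Set X} (hC : ∀ n, IsCompact (C n)) {k : ℕ}
    (hdim : ∀ n, dimH (C n) < k) {S : Set (LipSpace X)} (hS : collisionFree μ T C k ⊆ S) :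
    IsPrevalent S := by
  set Φ := polyProbe X (Fin k ⊕ Fin k) with hΦ
  have hBm := measurableSet_collisionFree μ hT.continuous hC k
  set Q := Metric.closedBall (0 : (Fin k ⊕ Fin k → Option (Fin N)) → ℝ) 1 with hQ
  have hQc : IsCompact Q := isCompact_closedBall 0 1
  have hΦQ : IsCompact (Φ '' Q) := hQc.image Φ.continuous
  refine ⟨_, hS, hBm, (volume.restrict Q).map Φ, ⟨Φ '' Q, hΦQ, ?_, ?_⟩, fun v => ?_⟩
  · rw [Measure.map_apply Φ.continuous.measurable hΦQ.isClosed.measurableSet,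
      Measure.restrict_apply' hQc.measurableSet,
      Set.inter_eq_self_of_subset_right (Set.subset_preimage_image Φ Q)]
    exact Metric.measure_closedBall_pos _ _ one_pos
  · rw [Measure.map_apply Φ.continuous.measurable hΦQ.isClosed.measurableSet,
      Measure.restrict_apply' hQc.measurableSet]
    exact (measure_mono Set.inter_subset_right).trans_lt hQc.measure_lt_top
  · refine (ae_map_iff Φ.continuous.aemeasurable (p := fun e => v + e ∈ collisionFree μ T C k)
      (hBm.preimage (continuous_const.add continuous_id).measurable)).2 ?_
    exact ae_restrict_of_ae (ae_add_polyProbe_mem_collisionFree μ hT hC hdim v)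

end Prevalent

end LipSpace

/-! ### Compact carriers of small dimension and the conclusion. -/

/-- A measure on a subset of `ℝ^N` of dimension less than `d` is carried by countably many compact
sets of dimension less than `d`. -/
theorem exists_isCompact_exhaustion_of_measureDimH_lt {N : ℕ} {X : Set (EuclideanSpace ℝ (Fin N))}
    [CompactSpace X] (μ : Measure X) [IsFiniteMeasure μ] {d : ℝ≥0∞}
    (hd : measureDimH (μ.map (Subtype.val : X → EuclideanSpace ℝ (Fin N))) < d) :
    ∃ C : ℕ → Set X, (∀ n, IsCompact (C n)) ∧ (∀ n, dimH (C n) < d) ∧ μ (⋃ n, C n)ᶜ = 0 := by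
  simp only [measureDimH, iInf_lt_iff] at hd
  obtain ⟨s, hs, h0, hdim⟩ := hd
  rw [Measure.map_apply measurable_subtype_coe hs.compl, Set.preimage_compl] at h0
  obtain ⟨C, -, hC, hCs, hC0⟩ := exists_monotone_isCompact_exhaustion μ
    (measurable_subtype_coe hs : MeasurableSet ((Subtype.val : X → _) ⁻¹' s))
  refine ⟨C, hC, fun n => ?_, measure_mono_null (fun x hx => ?_) (measure_union_null hC0 h0)⟩
  · rw [← isometry_subtype_coe.dimH_image]
    exact (dimH_mono (Set.image_subset_iff.2 (hCs n))).trans_lt hdim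
  · by_cases hxs : x ∈ (Subtype.val : X → _) ⁻¹' s
    · exact Or.inl ⟨hxs, hx⟩
    · exact Or.inr hxs

theorem measureDimH_lt_finrank_add_one {N : ℕ} (μ : Measure (EuclideanSpace ℝ (Fin N))) :
    measureDimH μ < ((N + 1 : ℕ) : ℝ≥0∞) := by
  refine (iInf₂_le_of_le Set.univ MeasurableSet.univ (iInf_le _ (by simp))).trans_lt ?_
  rw [Real.dimH_univ_eq_finrank, finrank_euclideanSpace, Fintype.card_fin]
  exact_mod_cast Nat.lt_succ_self N

theorem theorem1p6 {N : ℕ} (X : Set (EuclideanSpace ℝ (Fin N))) [CompactSpace X]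
    (μ : Measure X) [IsProbabilityMeasure μ] (T : X → X) (K : ℝ≥0) (hT : LipschitzWith K T) :
    IsPrevalent {h : LipSpace X | ∀ k : ℕ,
      measureDimH (μ.map (Subtype.val : X → EuclideanSpace ℝ (Fin N))) < (k : ℝ≥0∞) →
        AlmostSurelyPredictable μ T h k} := by
  classical
  have hex : ∃ k : ℕ,
      measureDimH (μ.map (Subtype.val : X → EuclideanSpace ℝ (Fin N))) < (k : ℝ≥0∞) :=
    ⟨N + 1, measureDimH_lt_finrank_add_one _⟩
  -- The least admissible `k` gives one probe and one Borel set that serve all larger `k` at once.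
  obtain ⟨C, hC, hdim, hfull⟩ := exists_isCompact_exhaustion_of_measureDimH_lt μ (Nat.find_spec hex)
  exact LipSpace.isPrevalent_of_collisionFree_subset μ hT hC hdim fun h hh k hk =>
    LipSpace.almostSurelyPredictable_of_mem_collisionFree μ hT.continuous hC hfull
      (Nat.find_min' hex hk) hh
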